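/- Let $A$ be an idiom, i.e. a complete lattice that is modular and upper-continuous ($a\wedge\bigvee X=\bigvee_{x\in X}(a\wedge x)$ for directed $X\subseteq A$), and let $j$ be a nucleus on $A$ (an inflationary, idempotent map $A\to A$ that preserves binary meets). Intervals are $[a,b]=\{x : a\le x\le b\}$ with $a\le b$ in $A$; two intervals are similar if they are $[l,l\vee r]$ and $[l\wedge r,r]$, in either order, for some $l,r\in A$. A set of intervals is *basic* if it is nonempty and closed under similarity and under subintervals. It is a *division set* if it is basic, $[a,b],[b,c]\in\mathcal D$ implies $[a,c]\in\mathcal D$, and $[a,\bigvee X]\in\mathcal D$ whenever $X\neq\emptyset$ and $[a,x]\in\mathcal D$ for all $x\in X$. For basic sets $\mathcal A,\mathcal B$ let $\mathcal A\succ\mathcal B$ be the largest basic set $\mathcal X$ with $\mathcal X\cap\mathcal A\subseteq\mathcal B$ (the implication of the frame of basic sets). For a set $\mathcal B$ of intervals let $|\mathcal B|(a)=\bigvee\{x : [a,x]\in\mathcal B\}$. Put $\mathcal D_j=\{[a,b] : j(a)=j(b)\}$, and define: - $\mathrm{Crt}(\mathcal D_j)$ (critical intervals): all $[a,b]$ such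 that for every $x\in[a,b]$, $x=a$ or $[x,b]\in\mathcal D_j$; - $\mathrm{Fll}(\mathcal D_j)$ (full intervals): all $[a,b]$ such that for every $x\in[a,b]$ there is $y\in[a,b]$ with $x\wedge y=a$ and $[x\vee y,b]\in\mathcal D_j$; - $\mathrm{Sct}(\mathcal D_j)$ (semicritical intervals): all $[a,b]$ for which there is a nonempty $X\subseteq[a,b]$ with $[a,x]\in\mathrm{Crt}(\mathcal D_j)$ for all $x\in X$ and $[\bigvee X,b]\in\mathcal D_j$; - $\mathrm{Gab}(\mathcal D_j)$: the least division set that contains $\mathrm{Crt}(\mathcal D_j)$; - $soc_j=|\mathrm{Sct}(\mathcal D_j)|$, $\ cbd_j=|\mathrm{Fll}(\mathcal D_j)|$, $\ fbl_j=|\mathrm{Fll}(\mathcal D_j)\succ\mathrm{Gab}(\mathcal D_j)|$. Functions $A\to A$ are compared pointwise, $tp$ is the constant function with value $1=\max A$, and $d^\infty$ is the stable value of the transfinite iterates $d^0=\mathrm{id}$, $d^{\alpha+1}=d\circ d^\alpha$, $d^\lambda=\bigvee_{\alpha<\lambda}d^\alpha$ for limit $\lambda$. **Theorem.** The following conditions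 are equivalent: 1. $soc_j=cbd_j$; 2. $cbd_j\le soc_j^\infty$; 3. $cbd_j\le fbl_j$; 4. $cbd_j^\infty\le soc_j^\infty$; 5. $fbl_j=tp$; 6. $\mathrm{Sct}(\mathcal D_j)=\mathrm{Fll}(\mathcal D_j)$; 7. $\mathrm{Fll}(\mathcal D_j)\subseteq\mathrm{Gab}(\mathcal D_j)$; 8. $\mathrm{Fll}(\mathcal D_j)\subseteq(\mathrm{Fll}(\mathcal D_j)\succ\mathrm{Gab}(\mathcal D_j))$. -/

import Mathlib

universe u

/-- An idiom: a complete, modular, upper-continuous lattice. -/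
class IsIdiom (A : Type u) [CompleteLattice A] : Prop extends IsModularLattice A where
  inf_sSup_of_directedOn : ∀ (a : A) (X : Set A), DirectedOn (fun x y => x ≤ y) X →
    a ⊓ sSup X = ⨆ x ∈ X, a ⊓ x

namespace Idiom

variable {A : Type u} [CompleteLattice A]

/-- `[a, b] ∈ B`: the pair `a`, `b` satisfies `a ≤ b` and the interval `[a, b]` belongs to the set
of intervals `B`.  Intervals of `A` are the elements of `NonemptyInterval A`, whose order `J ≤ I`
is "`J` is a subinterval of `I`". -/
def Has (B : Set (NonemptyInterval A)) (a b : A) : Prop :=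
  ∃ h : a ≤ b, (⟨(a, b), h⟩ : NonemptyInterval A) ∈ B

/-- Similar intervals: one of them is `[l, l ⊔ r]` and the other one is `[l ⊓ r, r]`. -/
def Similar (J I : NonemptyInterval A) : Prop :=
  ∃ l r : A,
    (J = ⟨(l, l ⊔ r), le_sup_left⟩ ∧ I = ⟨(l ⊓ r, r), inf_le_right⟩) ∨
    (J = ⟨(l ⊓ r, r), inf_le_right⟩ ∧ I = ⟨(l, l ⊔ r), le_sup_left⟩)

/-- Abstract sets of intervals: nonempty and closed under similarity. -/
def IsAbstract (B : Set (NonemptyInterval A)) : Prop :=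
  B.Nonempty ∧ ∀ I J : NonemptyInterval A, Similar J I → I ∈ B → J ∈ B

/-- Basic sets: abstract sets that are closed under subintervals. -/
def IsBasic (B : Set (NonemptyInterval A)) : Prop :=
  IsAbstract B ∧ ∀ I J : NonemptyInterval A, J ≤ I → I ∈ B → J ∈ B

/-- Congruence sets: basic sets that are closed under abutting intervals. -/
def IsCongruence (B : Set (NonemptyInterval A)) : Prop :=
  IsBasic B ∧ ∀ a b c : A, Has B a b → Has B b c → Has B a c

/-- Pre-division sets.  (For the empty family the supremum taken in `[a, 1]` is `a`, and the
trivial interval `[a, a]` belongs to every basic set.) -/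
def IsPreDivision (B : Set (NonemptyInterval A)) : Prop :=
  IsBasic B ∧ ∀ (a : A) (X : Set A), X.Nonempty → (∀ x ∈ X, Has B a x) → Has B a (sSup X)

/-- Division sets. -/
def IsDivision (B : Set (NonemptyInterval A)) : Prop :=
  IsCongruence B ∧ IsPreDivision B

/-- The least division set that contains `B`. -/
def Dvs (B : Set (NonemptyInterval A)) : Set (NonemptyInterval A) :=
  ⋂₀ {D | IsDivision D ∧ B ⊆ D}

/-- The implication `B ≻ C` of the frame of basic sets, that is, the largest basic set `X` with
`X ∩ B ⊆ C`; suprema of basic sets are unions. -/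
def imp (B C : Set (NonemptyInterval A)) : Set (NonemptyInterval A) :=
  ⋃₀ {X | IsBasic X ∧ X ∩ B ⊆ C}

/-- The function `|B| : A → A` associated with a set of intervals `B`. -/
def assoc (B : Set (NonemptyInterval A)) (a : A) : A :=
  sSup {x | Has B a x}

/-- The division set `D_j` of a nucleus `j`. -/
def divSet (j : Nucleus A) : Set (NonemptyInterval A) :=
  {I | j I.fst = j I.snd}

/-- `B`-critical intervals. -/
def Crt (B : Set (NonemptyInterval A)) : Set (NonemptyInterval A) :=
  {I | ∀ x : A, I.fst ≤ x → x ≤ I.snd → I.fst = x ∨ Has B x I.snd}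

/-- `B`-full intervals. -/
def Fll (B : Set (NonemptyInterval A)) : Set (NonemptyInterval A) :=
  {I | ∀ x : A, I.fst ≤ x → x ≤ I.snd →
    ∃ y : A, I.fst ≤ y ∧ y ≤ I.snd ∧ I.fst = x ⊓ y ∧ Has B (x ⊔ y) I.snd}

/-- `B`-semicritical intervals: up to `B`, the interval `[a, b]` is generated by a family of
critical intervals `[a, x]`. -/
def Sct (B : Set (NonemptyInterval A)) : Set (NonemptyInterval A) :=
  {I | ∃ X : Set A, X.Nonempty ∧ (∀ x ∈ X, x ≤ I.snd ∧ Has (Crt B) I.fst x) ∧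
    Has B (sSup X) I.snd}

/-- The Gabriel derivative on sets of intervals. -/
def Gab (B : Set (NonemptyInterval A)) : Set (NonemptyInterval A) :=
  Dvs (Crt B)

/-- The socle derivative relative to `j`: the inflator of the set of `j`-semicritical intervals, so
that `[a, b]` is `j`-semicritical if and only if `b ≤ soc j a`. -/
def soc (j : Nucleus A) : A → A :=
  assoc (Sct (divSet j))

/-- The Cantor-Bendixson derivative relative to `j`. -/
def cbd (j : Nucleus A) : A → A :=
  assoc (Fll (divSet j))

/-- The function (a nucleus on `A`) that corresponds to `Fll(D_j) ≻ Gab(D_j)`. -/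
def fbl (j : Nucleus A) : A → A :=
  assoc (imp (Fll (divSet j)) (Gab (divSet j)))

/-- The closure `d^∞` of an inflator `d`: the supremum of the transfinite iterates `d^α`
(`d^0 = id`, `d^(α+1) = d ∘ d^α`, pointwise suprema at limits).  This chain is increasing and
stabilizes at an ordinal of the universe of `A`, so the supremum is its stable value. -/
noncomputable def infClosure (d : A → A) (a : A) : A :=
  ⨆ α : Ordinal.{u}, transfiniteIterate d α a

end Idiom

namespace Idiom

variable {A : Type u} [CompleteLattice A] {B F G : Set (NonemptyInterval A)} {a b c d : A}

theorem Has.le (h : Has B a b) : a ≤ b := h.1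

theorem has_mk {I : NonemptyInterval A} : Has B I.fst I.snd ↔ I ∈ B :=
  ⟨fun h => h.2, fun h => ⟨_, h⟩⟩

theorem Has.mono (h : F ⊆ G) (hF : Has F a b) : Has G a b := ⟨hF.1, h hF.2⟩

theorem subset_of_has (h : ∀ a b, Has F a b → Has G a b) : F ⊆ G :=
  fun _ hI => has_mk.1 (h _ _ (has_mk.2 hI))

theorem IsAbstract.has_sup_iff (hB : IsAbstract B) (l r : A) :
    Has B l (l ⊔ r) ↔ Has B (l ⊓ r) r :=
  ⟨fun h => ⟨inf_le_right, hB.2 _ _ ⟨l, r, Or.inr ⟨rfl, rfl⟩⟩ h.2⟩,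
    fun h => ⟨le_sup_left, hB.2 _ _ ⟨l, r, Or.inl ⟨rfl, rfl⟩⟩ h.2⟩⟩

theorem isAbstract_of_has (h₀ : ∀ a, Has B a a)
    (h : ∀ l r, Has B l (l ⊔ r) ↔ Has B (l ⊓ r) r) : IsAbstract B := by
  refine ⟨⟨_, (h₀ ⊥).2⟩, ?_⟩
  rintro I J ⟨l, r, ⟨rfl, rfl⟩ | ⟨rfl, rfl⟩⟩ hI
  · exact ((h l r).2 ⟨_, hI⟩).2
  · exact ((h l r).1 ⟨_, hI⟩).2

theorem IsBasic.has_sub (hB : IsBasic B) (h : Has B a b) (hac : a ≤ c) (hcd : c ≤ d)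
    (hdb : d ≤ b) : Has B c d :=
  ⟨hcd, hB.2 ⟨(a, b), h.1⟩ ⟨(c, d), hcd⟩ (NonemptyInterval.le_def.2 ⟨hac, hdb⟩) h.2⟩

theorem isBasic_of_has (h₀ : ∀ a, Has B a a)
    (h : ∀ l r, Has B l (l ⊔ r) ↔ Has B (l ⊓ r) r)
    (hs : ∀ a b c d, Has B a b → a ≤ c → c ≤ d → d ≤ b → Has B c d) : IsBasic B :=
  ⟨isAbstract_of_has h₀ h, fun _ _ hJ hI =>
    has_mk.1 (hs _ _ _ _ (has_mk.2 hI) (NonemptyInterval.le_def.1 hJ).1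
      (NonemptyInterval.fst_le_snd _)
      (NonemptyInterval.le_def.1 hJ).2)⟩

theorem IsBasic.has_refl (hB : IsBasic B) (a : A) : Has B a a := by
  obtain ⟨I, hI⟩ := hB.1.1
  have h₁ : Has B I.fst I.fst := hB.has_sub (has_mk.2 hI) le_rfl le_rfl I.2
  have h₂ := (hB.1.has_sup_iff I.fst (I.fst ⊓ a)).1 (by simpa using h₁)
  have h₃ := (hB.1.has_sup_iff a (I.fst ⊓ a)).2
    (by simpa [← inf_assoc, inf_comm, inf_left_comm] using h₂)
  simpa using h₃

theorem isBasic_univ : IsBasic (Set.univ : Set (NonemptyInterval A)) :=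
  ⟨⟨⟨⟨(⊥, ⊥), le_rfl⟩, trivial⟩, fun _ _ _ _ => trivial⟩, fun _ _ _ _ => trivial⟩

/-- The intervals all of whose subintervals in `F` belong to `G`. -/
def Localized (F G : Set (NonemptyInterval A)) : Set (NonemptyInterval A) :=
  {I | ∀ c d, I.fst ≤ c → d ≤ I.snd → Has F c d → Has G c d}

theorem has_localized_iff :
    Has (Localized F G) a b ↔ a ≤ b ∧ ∀ c d, a ≤ c → d ≤ b → Has F c d → Has G c d :=
  ⟨fun h => ⟨h.1, h.2⟩, fun h => ⟨h.1, h.2⟩⟩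

theorem imp_subset_localized : imp F G ⊆ Localized F G := by
  rintro I ⟨X, ⟨hX, hXG⟩, hI⟩ c d hc hd hF
  have hc' := hX.has_sub (has_mk.2 hI) hc hF.le hd
  exact ⟨hF.le, hXG ⟨hc'.2, hF.2⟩⟩

section Modular

variable [IsModularLattice A]

theorem inf_sup_left_transport {l e f r : A} (hl : l ⊓ r ≤ e) (hef : e ≤ f) (hf : f ≤ r) :
    (l ⊔ e) ⊓ f = e := by
  rw [sup_comm, sup_inf_assoc_of_le _ hef]
  exact sup_eq_left.2 ((inf_le_inf_left _ hf).trans hl)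

theorem sup_inf_right_transport {l e f r : A} (hl : l ≤ e) (hef : e ≤ f) (hf : f ≤ l ⊔ r) :
    e ⊔ f ⊓ r = f := by
  rw [inf_comm, ← sup_inf_assoc_of_le _ hef]
  exact inf_eq_right.2 (hf.trans (sup_le_sup_right hl _))

theorem IsAbstract.has_transport_up (hB : IsAbstract B) {l r e f : A} (hl : l ⊓ r ≤ e)
    (hef : e ≤ f) (hf : f ≤ r) : Has B (l ⊔ e) (l ⊔ f) ↔ Has B e f := by
  have h := hB.has_sup_iff (l ⊔ e) f
  rwa [inf_sup_left_transport hl hef hf, sup_assoc, sup_eq_right.2 hef] at h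

theorem IsAbstract.has_transport_down (hB : IsAbstract B) {l r e f : A} (hl : l ≤ e)
    (hef : e ≤ f) (hf : f ≤ l ⊔ r) : Has B (e ⊓ r) (f ⊓ r) ↔ Has B e f := by
  have h := hB.has_sup_iff e (f ⊓ r)
  rw [sup_inf_right_transport hl hef hf, ← inf_assoc, inf_eq_left.2 hef] at h
  exact h.symm

theorem isBasic_localized (hF : IsBasic F) (hG : IsAbstract G) (hG₀ : ∀ a, Has G a a) :
    IsBasic (Localized F G) := by
  refine isBasic_of_has (fun a => ?_) (fun l r => ?_) (fun a b c d h hac hcd hdb => ?_)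
  · refine has_localized_iff.2 ⟨le_rfl, fun c d hc hd h => ?_⟩
    obtain rfl := le_antisymm h.le (hd.trans hc)
    exact hG₀ c
  · rw [has_localized_iff, has_localized_iff]
    refine ⟨fun h => ⟨inf_le_right, fun c d hc hd hcd => ?_⟩,
      fun h => ⟨le_sup_left, fun c d hc hd hcd => ?_⟩⟩
    · rw [← hG.has_transport_up hc hcd.le hd]
      rw [← hF.1.has_transport_up hc hcd.le hd] at hcd
      exact h.2 _ _ le_sup_left (sup_le_sup_left hd _) hcd
    · rw [← hG.has_transport_down hc hcd.le hd]
      rw [← hF.1.has_transport_down hc hcd.le hd] at hcd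
      exact h.2 _ _ (inf_le_inf_right _ hc) inf_le_right hcd
  · rw [has_localized_iff] at h ⊢
    exact ⟨hcd, fun e f he hf => h.2 e f (hac.trans he) (hf.trans hdb)⟩

theorem isCongruence_localized (hF : IsBasic F) (hG : IsAbstract G) (hG₀ : ∀ a, Has G a a)
    (hGt : ∀ a b c, Has G a b → Has G b c → Has G a c) : IsCongruence (Localized F G) := by
  refine ⟨isBasic_localized hF hG hG₀, fun a b c hab hbc => ?_⟩
  rw [has_localized_iff] at *
  refine ⟨hab.1.trans hbc.1, fun d e hd he hde => ?_⟩
  have h₁ : d ≤ e ⊓ (d ⊔ b) := le_inf hde.le le_sup_left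
  refine hGt d (e ⊓ (d ⊔ b)) e ?_ ?_
  · have hF' := hF.has_sub hde le_rfl h₁ inf_le_left
    have hle : e ⊓ (d ⊔ b) ≤ d ⊔ b := inf_le_right
    rw [← hG.has_transport_down le_rfl h₁ hle]
    rw [← hF.1.has_transport_down le_rfl h₁ hle] at hF'
    exact hab.2 _ _ (le_inf hd hab.1) inf_le_right hF'
  · have hF' := hF.has_sub hde h₁ inf_le_left le_rfl
    rw [inf_comm] at hF' ⊢
    rw [← hG.has_sup_iff]
    rw [← hF.1.has_sup_iff] at hF'
    exact hbc.2 _ _ le_sup_right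
      (sup_le (sup_le (hde.le.trans he) hbc.1) he) hF'

end Modular

section IsIdiom

variable [IsIdiom A]

theorem inf_sSup_of_directedOn (a : A) {X : Set A} (hX : DirectedOn (fun x y => x ≤ y) X) :
    a ⊓ sSup X = ⨆ x ∈ X, a ⊓ x :=
  IsIdiom.inf_sSup_of_directedOn a X hX

theorem isDivision_localized (hF : IsBasic F) (hG : IsAbstract G) (hG₀ : ∀ a, Has G a a)
    (hGt : ∀ a b c, Has G a b → Has G b c → Has G a c)
    (hGs : ∀ (a : A) (X : Set A), X.Nonempty → (∀ x ∈ X, Has G a x) → Has G a (sSup X)) :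
    IsDivision (Localized F G) := by
  have hE := isCongruence_localized hF hG hG₀ hGt
  refine ⟨hE, hE.1, fun a X hX h => ?_⟩
  set Y : Set A := {y | Has (Localized F G) a y}
  have hY : DirectedOn (fun x y => x ≤ y) Y := fun x hx y hy =>
    ⟨x ⊔ y, hE.2 a x _ hx ((hE.1.1.has_sup_iff x y).2
      (hE.1.has_sub hy (le_inf hx.le hy.le) inf_le_right le_rfl)), le_sup_left, le_sup_right⟩
  obtain ⟨x₀, hx₀⟩ := hX
  refine has_localized_iff.2 ⟨(h x₀ hx₀).le.trans (le_sSup hx₀), fun c d hc hd hcd => ?_⟩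
  have hd' : d = ⨆ y ∈ Y, d ⊓ y := by
    have hle : d ≤ sSup Y := hd.trans (sSup_le_sSup h)
    rw [← inf_sSup_of_directedOn d hY, inf_eq_left.2 hle]
  have hsup : sSup ((fun y => c ⊔ d ⊓ y) '' Y) = d := by
    refine le_antisymm (sSup_le ?_) ?_
    · rintro _ ⟨y, -, rfl⟩
      exact sup_le hcd.le inf_le_left
    · conv_lhs => rw [hd']
      exact iSup₂_le fun y hy => le_sup_right.trans (le_sSup ⟨y, hy, rfl⟩)
  rw [← hsup]
  refine hGs _ _ ⟨_, x₀, h x₀ hx₀, rfl⟩ ?_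
  rintro _ ⟨y, hy, rfl⟩
  have hF' : Has F c (c ⊔ d ⊓ y) :=
    hF.has_sub hcd le_rfl le_sup_left (sup_le hcd.le inf_le_left)
  rw [hF.1.has_sup_iff] at hF'
  exact (hG.has_sup_iff _ _).2 ((has_localized_iff.1 hy).2 _ _
    (le_inf hc (le_inf (hc.trans hcd.le) hy.le)) inf_le_right hF')

end IsIdiom

theorem has_dvs_iff :
    Has (Dvs B) a b ↔ a ≤ b ∧ ∀ D, IsDivision D → B ⊆ D → Has D a b :=
  ⟨fun h => ⟨h.1, fun D hD hB => ⟨h.1, h.2 D ⟨hD, hB⟩⟩⟩,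
    fun h => ⟨h.1, fun D hD => (h.2 D hD.1 hD.2).2⟩⟩

theorem subset_dvs : B ⊆ Dvs B := fun _ hI _ hD => hD.2 hI

theorem isDivision_dvs : IsDivision (Dvs B) := by
  have hb : IsBasic (Dvs B) := by
    refine isBasic_of_has (fun a => ?_) (fun l r => ?_) (fun a b c d h hac hcd hdb => ?_)
    · exact has_dvs_iff.2 ⟨le_rfl, fun D hD _ => hD.1.1.has_refl a⟩
    · exact ⟨fun h => has_dvs_iff.2 ⟨inf_le_right, fun D hD hB =>
          (hD.1.1.1.has_sup_iff l r).1 ((has_dvs_iff.1 h).2 D hD hB)⟩,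
        fun h => has_dvs_iff.2 ⟨le_sup_left, fun D hD hB =>
          (hD.1.1.1.has_sup_iff l r).2 ((has_dvs_iff.1 h).2 D hD hB)⟩⟩
    · exact has_dvs_iff.2 ⟨hcd, fun D hD hB =>
        hD.1.1.has_sub ((has_dvs_iff.1 h).2 D hD hB) hac hcd hdb⟩
  refine ⟨⟨hb, fun a b c hab hbc => ?_⟩, hb, fun a X hX h => ?_⟩
  · exact has_dvs_iff.2 ⟨hab.le.trans hbc.le, fun D hD hB =>
      hD.1.2 a b c ((has_dvs_iff.1 hab).2 D hD hB) ((has_dvs_iff.1 hbc).2 D hD hB)⟩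
  · obtain ⟨x, hx⟩ := hX
    exact has_dvs_iff.2 ⟨(h x hx).le.trans (le_sSup hx), fun D hD hB =>
      hD.2.2 a X ⟨x, hx⟩ fun y hy => (has_dvs_iff.1 (h y hy)).2 D hD hB⟩

variable {j : Nucleus A}

theorem le_nucleus_iff : a ≤ j b ↔ j a ≤ j b :=
  ⟨fun h => (j.monotone h).trans_eq (Nucleus.idempotent b), fun h => j.le_apply.trans h⟩

theorem has_divSet_iff : Has (divSet j) a b ↔ a ≤ b ∧ b ≤ j a :=
  ⟨fun h => ⟨h.1, le_nucleus_iff.2 (Eq.ge h.2)⟩,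
    fun h => ⟨h.1, le_antisymm (j.monotone h.1) (le_nucleus_iff.1 h.2)⟩⟩

theorem isBasic_divSet : IsBasic (divSet j) := by
  refine isBasic_of_has (fun a => ?_) (fun l r => ?_) (fun a b c d h hac hcd hdb => ?_)
  · exact has_divSet_iff.2 ⟨le_rfl, j.le_apply⟩
  · simp [has_divSet_iff, j.le_apply]
  · rw [has_divSet_iff] at *
    exact ⟨hcd, hdb.trans (h.2.trans (j.monotone hac))⟩

theorem has_crt_iff : Has (Crt (divSet j)) a b ↔
    a ≤ b ∧ ∀ x, a ≤ x → x ≤ b → a = x ∨ b ≤ j x :=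
  ⟨fun h => ⟨h.1, fun x hx hx' => (h.2 x hx hx').imp_right fun h => (has_divSet_iff.1 h).2⟩,
    fun h => ⟨h.1, fun x hx hx' =>
      (h.2 x hx hx').imp_right fun h => has_divSet_iff.2 ⟨hx', h⟩⟩⟩

theorem has_fll_iff : Has (Fll (divSet j)) a b ↔
    a ≤ b ∧ ∀ x, a ≤ x → x ≤ b → ∃ y, a ≤ y ∧ y ≤ b ∧ x ⊓ y ≤ a ∧ b ≤ j (x ⊔ y) := by
  refine ⟨fun h => ⟨h.1, fun x hx hx' => ?_⟩, fun h => ⟨h.1, fun x hx hx' => ?_⟩⟩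
  · obtain ⟨y, h₁, h₂, h₃, h₄⟩ := h.2 x hx hx'
    exact ⟨y, h₁, h₂, h₃.ge, (has_divSet_iff.1 h₄).2⟩
  · obtain ⟨y, h₁, h₂, h₃, h₄⟩ := h.2 x hx hx'
    exact ⟨y, h₁, h₂, le_antisymm (le_inf hx h₁) h₃, has_divSet_iff.2 ⟨sup_le hx' h₂, h₄⟩⟩

theorem has_sct_iff : Has (Sct (divSet j)) a b ↔
    ∃ X : Set A, X.Nonempty ∧ (∀ x ∈ X, x ≤ b ∧ Has (Crt (divSet j)) a x) ∧
      b ≤ j (sSup X) := by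
  constructor
  · rintro ⟨_, X, hX, h, hD⟩
    exact ⟨X, hX, h, (has_divSet_iff.1 hD).2⟩
  · rintro ⟨X, ⟨x, hx⟩, h, hD⟩
    exact ⟨(h x hx).2.le.trans (h x hx).1, X, ⟨x, hx⟩, h,
      has_divSet_iff.2 ⟨sSup_le fun y hy => (h y hy).1, hD⟩⟩

theorem divSet_subset_crt : divSet j ⊆ Crt (divSet j) :=
  subset_of_has fun _ _ h => has_crt_iff.2 ⟨h.le, fun _ hx _ =>
    Or.inr ((has_divSet_iff.1 h).2.trans (j.monotone hx))⟩

theorem has_crt_refl (a : A) : Has (Crt (divSet j)) a a :=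
  (isBasic_divSet.has_refl a).mono divSet_subset_crt

theorem isAbstract_crt [IsModularLattice A] : IsAbstract (Crt (divSet j)) := by
  refine isAbstract_of_has has_crt_refl (fun l r => ?_)
  rw [has_crt_iff, has_crt_iff]
  refine ⟨fun h => ⟨inf_le_right, fun x hx hx' => ?_⟩,
    fun h => ⟨le_sup_left, fun x hx hx' => ?_⟩⟩
  · rcases h.2 (l ⊔ x) le_sup_left (sup_le_sup_left hx' _) with h | h
    · exact Or.inl (le_antisymm hx (le_inf (sup_eq_left.1 h.symm) hx'))
    · right
      rw [← inf_sup_left_transport hx hx' le_rfl, Nucleus.map_inf]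
      exact le_inf (le_sup_right.trans h) j.le_apply
  · rcases h.2 (x ⊓ r) (inf_le_inf_right _ hx) inf_le_right with h | h
    · left
      have hx'' := sup_inf_right_transport le_rfl hx hx'
      rwa [← h, sup_inf_self] at hx''
    · exact Or.inr (sup_le (hx.trans j.le_apply) (h.trans (j.monotone inf_le_left)))

theorem crt_subset_sct : Crt (divSet j) ⊆ Sct (divSet j) :=
  subset_of_has fun a b h => has_sct_iff.2 ⟨{b}, Set.singleton_nonempty b,
    fun x hx => by obtain rfl := hx; exact ⟨le_rfl, h⟩, by simpa using j.le_apply⟩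

theorem isBasic_fll [IsModularLattice A] : IsBasic (Fll (divSet j)) := by
  refine isBasic_of_has (fun a => ?_) (fun l r => ?_) (fun a b c d h hac hcd hdb => ?_)
  · exact has_fll_iff.2 ⟨le_rfl, fun x hx hx' =>
      ⟨a, le_rfl, le_rfl, inf_le_right, le_sup_right.trans j.le_apply⟩⟩
  · rw [has_fll_iff, has_fll_iff]
    refine ⟨fun h => ⟨inf_le_right, fun x hx hx' => ?_⟩,
      fun h => ⟨le_sup_left, fun x hx hx' => ?_⟩⟩
    · obtain ⟨y, h₁, h₂, h₃, h₄⟩ := h.2 (l ⊔ x) le_sup_left (sup_le_sup_left hx' _)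
      refine ⟨y ⊓ r, inf_le_inf_right _ h₁, inf_le_right, ?_, ?_⟩
      · rw [← inf_assoc]
        exact inf_le_inf_right _ ((inf_le_inf_right _ le_sup_right).trans h₃)
      · rw [← sup_inf_assoc_of_le _ hx', Nucleus.map_inf]
        refine le_inf (le_sup_right.trans (h₄.trans (j.monotone ?_))) j.le_apply
        exact sup_le (sup_le (h₁.trans le_sup_right) le_sup_left) le_sup_right
    · obtain ⟨y, h₁, h₂, h₃, h₄⟩ := h.2 (x ⊓ r) (inf_le_inf_right _ hx) inf_le_right
      refine ⟨l ⊔ y, le_sup_left, sup_le_sup_left h₂ _, ?_, ?_⟩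
      · rw [inf_comm, sup_inf_assoc_of_le _ hx]
        refine sup_le le_rfl (le_trans ?_ (h₃.trans inf_le_left))
        exact le_inf (le_inf inf_le_right (inf_le_left.trans h₂)) inf_le_left
      · exact sup_le (hx.trans (le_sup_left.trans j.le_apply))
          (h₄.trans (j.monotone (sup_le_sup inf_le_left le_sup_right)))
  · rw [has_fll_iff] at *
    refine ⟨hcd, fun x hx hx' => ?_⟩
    obtain ⟨y, h₁, h₂, h₃, h₄⟩ := h.2 x (hac.trans hx) (hx'.trans hdb)
    refine ⟨(c ⊔ y) ⊓ d, le_inf le_sup_left hcd, inf_le_right, ?_, ?_⟩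
    · refine (inf_le_inf_left _ inf_le_left).trans ?_
      rw [inf_comm, sup_inf_assoc_of_le _ hx]
      exact sup_le le_rfl ((inf_comm y x).le.trans (h₃.trans hac))
    · rw [← sup_inf_assoc_of_le _ hx', Nucleus.map_inf]
      exact le_inf (hdb.trans (h₄.trans (j.monotone (sup_le_sup_left le_sup_right _))))
        j.le_apply

theorem inf_sup_le_of_independent [IsModularLattice A] {x y z : A} (hay : a ≤ y)
    (hxy : x ⊓ y ≤ a) (hz : z ⊓ (x ⊔ y) ≤ a) : x ⊓ (y ⊔ z) ≤ a := by
  have h : x ⊓ (y ⊔ z) ≤ y := calc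
    x ⊓ (y ⊔ z) ≤ (y ⊔ z) ⊓ (x ⊔ y) := le_inf inf_le_right (inf_le_left.trans le_sup_left)
    _ = y ⊔ z ⊓ (x ⊔ y) := sup_inf_assoc_of_le _ le_sup_right
    _ ≤ y := sup_le le_rfl (hz.trans hay)
  exact (le_inf inf_le_left h).trans hxy

theorem sct_subset_gab : Sct (divSet j) ⊆ Gab (divSet j) := by
  refine subset_of_has fun a b h => ?_
  obtain ⟨_, X, hX, hc, hD⟩ := h
  exact isDivision_dvs.1.2 _ _ _
    (isDivision_dvs.2.2 a X hX fun x hx => (hc x hx).2.mono subset_dvs)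
    (hD.mono (divSet_subset_crt.trans subset_dvs))

/-- The intervals that belong to `D_j` or have a `D_j`-critical subinterval outside `D_j`. -/
def DenseOrCritical (j : Nucleus A) : Set (NonemptyInterval A) :=
  {I | Has (divSet j) I.fst I.snd ∨ ∃ e f, I.fst ≤ e ∧ f ≤ I.snd ∧
    Has (Crt (divSet j)) e f ∧ ¬ Has (divSet j) e f}

theorem has_denseOrCritical_iff : Has (DenseOrCritical j) a b ↔ a ≤ b ∧
    (Has (divSet j) a b ∨ ∃ e f, a ≤ e ∧ f ≤ b ∧
      Has (Crt (divSet j)) e f ∧ ¬ Has (divSet j) e f) :=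
  ⟨fun h => ⟨h.1, h.2⟩, fun h => ⟨h.1, h.2⟩⟩

theorem crt_subset_localized_denseOrCritical :
    Crt (divSet j) ⊆ Localized Set.univ (DenseOrCritical j) := by
  intro I hI c d hc hd hcd
  refine has_denseOrCritical_iff.2 ⟨hcd.le, or_iff_not_imp_left.2 fun hn =>
    ⟨c, d, le_rfl, le_rfl, ?_, hn⟩⟩
  refine has_crt_iff.2 ⟨hcd.le, fun x hx hx' => ?_⟩
  rcases (has_crt_iff.1 (has_mk.2 hI)).2 x (hc.trans hx) (hx'.trans hd) with rfl | h
  · exact Or.inl (le_antisymm hx hc)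
  · exact Or.inr (hd.trans h)

section IsIdiom

variable [IsIdiom A]

theorem exists_maximal_inf_le (hab : a ≤ b) (x : A) :
    ∃ y, a ≤ y ∧ Maximal (fun y => y ≤ b ∧ x ⊓ y ≤ a) y := by
  refine zorn_le_nonempty₀ {y | y ≤ b ∧ x ⊓ y ≤ a} (fun C hC hchain y hy => ?_) a
    ⟨hab, inf_le_right⟩
  refine ⟨sSup C, ⟨sSup_le fun z hz => (hC hz).1, ?_⟩, fun z hz => le_sSup hz⟩
  rw [inf_sSup_of_directedOn x hchain.directedOn]
  exact iSup₂_le fun z hz => (hC hz).2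

theorem sct_subset_fll : Sct (divSet j) ⊆ Fll (divSet j) := by
  refine subset_of_has fun a b h => has_fll_iff.2 ⟨h.le, fun x hx hx' => ?_⟩
  obtain ⟨X, -, hc, hb⟩ := has_sct_iff.1 h
  obtain ⟨y, hay, ⟨hyb, hxy⟩, hmax⟩ := exists_maximal_inf_le h.le x
  refine ⟨y, hay, hyb, hxy, hb.trans (le_nucleus_iff.1 (sSup_le fun z hz => ?_))⟩
  obtain ⟨hzb, hz⟩ := hc z hz
  rcases (has_crt_iff.1 hz).2 (z ⊓ (x ⊔ y)) (le_inf hz.le (hay.trans le_sup_right))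
    inf_le_left with h | h
  · have hzy : z ≤ y := le_sup_right.trans
      (hmax ⟨sup_le hyb hzb, inf_sup_le_of_independent hay hxy h.ge⟩ le_sup_left)
    exact hzy.trans (le_sup_right.trans j.le_apply)
  · exact h.trans (j.monotone inf_le_right)

theorem isDivision_localized_denseOrCritical :
    IsDivision (Localized Set.univ (DenseOrCritical j)) := by
  have h₀ (a : A) : Has (DenseOrCritical j) a a :=
    has_denseOrCritical_iff.2 ⟨le_rfl, Or.inl (isBasic_divSet.has_refl a)⟩
  refine isDivision_localized isBasic_univ (isAbstract_of_has h₀ fun l r => ?_) h₀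
    (fun a b c hab hbc => ?_) (fun a X hX h => ?_)
  · rw [has_denseOrCritical_iff, has_denseOrCritical_iff]
    refine and_congr (by simp) (or_congr (isBasic_divSet.1.has_sup_iff l r) ⟨?_, ?_⟩)
    · rintro ⟨e, f, he, hf, hc, hd⟩
      refine ⟨e ⊓ r, f ⊓ r, inf_le_inf_right _ he, inf_le_right, ?_⟩
      rw [isAbstract_crt.has_transport_down he hc.le hf,
        isBasic_divSet.1.has_transport_down he hc.le hf]
      exact ⟨hc, hd⟩
    · rintro ⟨e, f, he, hf, hc, hd⟩
      refine ⟨l ⊔ e, l ⊔ f, le_sup_left, sup_le_sup_left hf _, ?_⟩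
      rw [isAbstract_crt.has_transport_up he hc.le hf,
        isBasic_divSet.1.has_transport_up he hc.le hf]
      exact ⟨hc, hd⟩
  · rw [has_denseOrCritical_iff] at *
    refine ⟨hab.1.trans hbc.1, ?_⟩
    rcases hab.2 with h₁ | ⟨e, f, he, hf, h⟩
    · rcases hbc.2 with h₂ | ⟨e, f, he, hf, h⟩
      · rw [has_divSet_iff] at h₁ h₂
        exact Or.inl (has_divSet_iff.2
          ⟨hab.1.trans hbc.1, h₂.2.trans (le_nucleus_iff.1 h₁.2)⟩)
      · exact Or.inr ⟨e, f, hab.1.trans he, hf, h⟩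
    · exact Or.inr ⟨e, f, he, hf.trans hbc.1, h⟩
  · obtain ⟨x₀, hx₀⟩ := hX
    have hle : a ≤ sSup X := (h x₀ hx₀).le.trans (le_sSup hx₀)
    refine has_denseOrCritical_iff.2 ⟨hle, or_iff_not_imp_right.2 fun hn => ?_⟩
    refine has_divSet_iff.2 ⟨hle, sSup_le fun x hx => ?_⟩
    rcases (has_denseOrCritical_iff.1 (h x hx)).2 with h₁ | ⟨e, f, he, hf, h'⟩
    · exact (has_divSet_iff.1 h₁).2
    · exact absurd ⟨e, f, he, hf.trans (le_sSup hx), h'⟩ hn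

theorem fll_inter_gab_subset_sct : Fll (divSet j) ∩ Gab (divSet j) ⊆ Sct (divSet j) := by
  refine subset_of_has fun a b h => ?_
  have hF : Has (Fll (divSet j)) a b := h.mono Set.inter_subset_left
  have hG : Has (Gab (divSet j)) a b := h.mono Set.inter_subset_right
  set X : Set A := {x | x ≤ b ∧ Has (Crt (divSet j)) a x}
  have haX : a ∈ X := ⟨h.le, has_crt_refl a⟩
  refine has_sct_iff.2 ⟨X, ⟨a, haX⟩, fun x hx => hx, ?_⟩
  obtain ⟨y, hay, hyb, hXy, hb⟩ := (has_fll_iff.1 hF).2 (sSup X) (le_sSup haX)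
    (sSup_le fun x hx => hx.1)
  have hL := (has_dvs_iff.1 hG).2 _ isDivision_localized_denseOrCritical
    crt_subset_localized_denseOrCritical
  rcases (has_denseOrCritical_iff.1 ((has_localized_iff.1 hL).2 a y le_rfl hyb
    ⟨hay, trivial⟩)).2 with hD | ⟨e, f, he, hf, hc, hd⟩
  · refine hb.trans (le_nucleus_iff.1 (sup_le j.le_apply ?_))
    exact (has_divSet_iff.1 hD).2.trans (j.monotone (le_sSup haX))
  · exfalso
    have hF' := isBasic_fll.has_sub hF le_rfl (he.trans hc.le) (hf.trans hyb)
    obtain ⟨z, haz, hzf, hez, hfz⟩ := (has_fll_iff.1 hF').2 e he hc.le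
    have hez' : e ⊓ z = a := le_antisymm hez (le_inf he haz)
    have hz : z ∈ X := by
      refine ⟨hzf.trans (hf.trans hyb), ?_⟩
      have := (isAbstract_crt (j := j)).has_sup_iff e z
      rw [hez'] at this
      refine this.1 (has_crt_iff.2 ⟨le_sup_left, fun x hx hx' => ?_⟩)
      exact ((has_crt_iff.1 hc).2 x hx (hx'.trans (sup_le hc.le hzf))).imp_right
        ((sup_le hc.le hzf).trans ·)
    have hza : z ≤ a := (le_inf (le_sSup hz) (hzf.trans hf)).trans hXy
    refine hd (has_divSet_iff.2 ⟨hc.le, hfz.trans (j.monotone (sup_le le_rfl (hza.trans he)))⟩)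

theorem has_gab_of_le_fbl (hF : Has (Fll (divSet j)) a b) (hb : b ≤ fbl j a) :
    Has (Gab (divSet j)) a b := by
  have hG : IsDivision (Gab (divSet j)) := isDivision_dvs
  have hL := isDivision_localized (isBasic_fll (j := j)) hG.1.1.1 hG.1.1.has_refl hG.1.2 hG.2.2
  have ha : Has (imp (Fll (divSet j)) (Gab (divSet j))) a a :=
    ⟨le_rfl, Gab (divSet j), ⟨hG.1.1, Set.inter_subset_left⟩, (hG.1.1.has_refl a).2⟩
  have := hL.2.2 a {x | Has (imp (Fll (divSet j)) (Gab (divSet j))) a x} ⟨a, ha⟩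
    fun x hx => Has.mono imp_subset_localized hx
  exact (has_localized_iff.1 this).2 a b le_rfl hb hF

end IsIdiom

theorem le_assoc (h : Has B a b) : b ≤ assoc B a := le_sSup h

theorem le_infClosure (d : A → A) : d ≤ infClosure d := fun a => by
  have h := transfiniteIterate_succ d a (⊥ : Ordinal.{u}) (not_isMax _)
  rw [transfiniteIterate_bot] at h
  exact h.ge.trans (le_iSup (fun α : Ordinal.{u} => transfiniteIterate d α a) _)

theorem IsDivision.has_infClosure (hB : IsDivision B) {d : A → A} (hd : ∀ a, Has B a (d a))
    (a : A) : Has B a (infClosure d a) := by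
  have key (α : Ordinal.{u}) : Has B a (transfiniteIterate d α a) := by
    induction α using SuccOrder.limitRecOn with
    | isMin α hα =>
      obtain rfl := hα.eq_bot
      rw [transfiniteIterate_bot]
      exact hB.1.1.has_refl a
    | succ α hα ih =>
      rw [transfiniteIterate_succ _ _ _ hα]
      exact hB.1.2 _ _ _ ih (hd _)
    | isSuccLimit α hα ih =>
      rw [transfiniteIterate_limit _ _ _ hα]
      refine hB.2.2 a _ ?_ ?_
      · exact ⟨_, ⟨⟨⊥, hα.bot_lt⟩, rfl⟩⟩
      · rintro _ ⟨⟨β, hβ⟩, rfl⟩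
        exact ih β hβ
  refine hB.2.2 a _ ⟨_, ⟨⊥, rfl⟩⟩ ?_
  rintro _ ⟨α, rfl⟩
  exact key α

theorem has_gab_soc (j : Nucleus A) (a : A) : Has (Gab (divSet j)) a (soc j a) :=
  isDivision_dvs.2.2 a _ ⟨a, (has_crt_refl a).mono crt_subset_sct⟩
    fun _ hx => Has.mono sct_subset_gab hx

theorem fbl_eq_top_of_subset (h : Fll (divSet j) ⊆ Gab (divSet j)) : fbl j = ⊤ := by
  funext a
  exact top_le_iff.1 (le_assoc ⟨le_top, Set.univ, ⟨isBasic_univ, fun _ hI => h hI.2⟩, trivial⟩)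

end Idiom

theorem mainTheorem6 {A : Type u} [CompleteLattice A] [IsIdiom A] (j : Nucleus A) :
    List.TFAE
      [ Idiom.soc j = Idiom.cbd j,
        Idiom.cbd j ≤ Idiom.infClosure (Idiom.soc j),
        Idiom.cbd j ≤ Idiom.fbl j,
        Idiom.infClosure (Idiom.cbd j) ≤ Idiom.infClosure (Idiom.soc j),
        Idiom.fbl j = (⊤ : A → A),
        Idiom.Sct (Idiom.divSet j) = Idiom.Fll (Idiom.divSet j),
        Idiom.Fll (Idiom.divSet j) ⊆ Idiom.Gab (Idiom.divSet j),
        Idiom.Fll (Idiom.divSet j) ⊆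
          Idiom.imp (Idiom.Fll (Idiom.divSet j)) (Idiom.Gab (Idiom.divSet j)) ] := by
  tfae_have 1 → 2 := fun h => h ▸ Idiom.le_infClosure _
  tfae_have 1 → 4 := fun h => h ▸ le_rfl
  tfae_have 4 → 2 := (Idiom.le_infClosure _).trans
  tfae_have 2 → 7 := fun h => Idiom.subset_of_has fun a b hF => by
    have hG := Idiom.isDivision_dvs.has_infClosure (Idiom.has_gab_soc j) a
    exact Idiom.isDivision_dvs.1.1.has_sub hG le_rfl hF.le ((Idiom.le_assoc hF).trans (h a))
  tfae_have 7 → 6 := fun h => Set.Subset.antisymm Idiom.sct_subset_fll fun _ hI =>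
    Idiom.fll_inter_gab_subset_sct ⟨hI, h hI⟩
  tfae_have 6 → 1 := congrArg Idiom.assoc
  tfae_have 7 → 8 := fun h =>
    Set.subset_sUnion_of_mem ⟨Idiom.isBasic_fll, Set.inter_subset_left.trans h⟩
  tfae_have 8 → 7 := fun h I hI => by
    obtain ⟨X, ⟨-, hX⟩, hIX⟩ := h hI
    exact hX ⟨hIX, hI⟩
  tfae_have 7 → 5 := Idiom.fbl_eq_top_of_subset
  tfae_have 5 → 3 := fun h => h ▸ le_top
  tfae_have 3 → 7 := fun h => Idiom.subset_of_has fun a b hF =>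
    Idiom.has_gab_of_le_fbl hF ((Idiom.le_assoc hF).trans (h a))
  tfae_finish
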